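/- Let $d=1$ and consider one of the following two models. \emph{Gaussian:} $p_\theta(x)=\frac{1}{\sqrt{2\pi}}e^{-(x-\theta)^2/2}$ on $\mathbb{R}$, with $\mu$ Lebesgue measure and $\Theta\subseteq\mathbb{R}$. \emph{Poisson:} $p_\theta(x)=\frac{\theta^x}{x!}e^{-\theta}$ on $\mathbb{N}=\{0,1,2,\dots\}$, with $\mu$ counting measure and $\Theta\subseteq(0,\infty)$. Let $\mathcal G$ be the set of probability measures supported on $\Theta$ (that is, giving no mass to the complement of $\Theta$), and for $g\in\mathcal G$ let $f_g(x)=\int_\Theta p_\theta(x)\,\mathrm{d}g(\theta)$. Let $g_0=\delta_{\theta_0}$ with $\theta_0\in\Theta$, let $X_1,X_2,\dots$ be i.i.d. with density $f_{g_0}$ with respect to $\mu$, and write $$\ell_n(f)=\sum_{i=1}^n\log f(X_i),\qquad \chi^2(f,f_0)=\Big\|\frac{f}{f_0}-1\Big\|^2_{L_2(f_0\,\mathrm{d}\mu)}\in[0,\infty].$$ Let $\hat g$ be any maximizer of $g\mapsto\ell_n(f_g)$ over $\mathcal G$ whenever one exists, and set $$\mathcal G_n(c)=\{g\in\mathcal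 G:\ell_n(f_g)\ge\ell_n(f_{g_0})+c\}\cup\{\hat g\},\qquad L_n(\mathcal G,g_0)=2\Big\{\sup_{g\in\mathcal G}\ell_n(f_g)-\ell_n(f_{g_0})\Big\},$$ where $\{\hat g\}$ is omitted from the union if no maximizer exists, and where the supremum over the empty set of the nonnegative quantities $n\,\chi^2$ is $0$. (If $\hat g$ exists, $L_n(\mathcal G,g_0)=2\{\ell_n(f_{\hat g})-\ell_n(f_{g_0})\}$.) In both models, if $\Theta$ is unbounded, then for every $c>0$, $$\sup_{g\in\mathcal G_n(c)} n\,\chi^2(f_g,f_{g_0})\to\infty\quad\text{in probability},$$ and moreover $L_n(\mathcal G,g_0)\to\infty$ in probability. Here $Y_n\to\infty$ in probability means that $\mathbb P(Y_n\le M)\to0$ for every $M\in\mathbb{R}$, with $\mathbb P$ read as outer probability, since the suprema need not be measurable. -/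

import Mathlib

open MeasureTheory ProbabilityTheory Filter Topology
open scoped ENNReal

namespace MixtureNPMLE

/-- The Gaussian location density `φ(x - θ)` with unit variance, with respect to Lebesgue
measure on `ℝ`. -/
noncomputable def gaussianDensity (θ x : ℝ) : ℝ := gaussianPDFReal θ 1 x

/-- The Poisson density `θ ^ k / k! * exp (-θ)`, with respect to counting measure on `ℕ`. -/
noncomputable def poissonDensity (θ : ℝ) (k : ℕ) : ℝ :=
  θ ^ k / (k.factorial : ℝ) * Real.exp (-θ)

/-- The class `𝒢` of mixing distributions: all probability measures that live on `Θ`. -/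
def mixingClass (Θ : Set ℝ) : Set (Measure ℝ) :=
  {g | IsProbabilityMeasure g ∧ g Θᶜ = 0}

section Mixture

variable {𝒳 : Type*}

/-- The mixture density `f_g (x) = ∫ p_θ (x) dg(θ)`. For `g ∈ mixingClass Θ`, the complement
of `Θ` does not contribute to the integral. -/
noncomputable def mixture (p : ℝ → 𝒳 → ℝ) (g : Measure ℝ) (x : 𝒳) : ℝ := ∫ θ, p θ x ∂g

/-- The log-likelihood `ℓ_n (f)` of the first `n` entries of the data sequence `x`. -/
noncomputable def logLik (f : 𝒳 → ℝ) (n : ℕ) (x : ℕ → 𝒳) : ℝ :=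
  ∑ i ∈ Finset.range n, Real.log (f (x i))

/-- The set of all nonparametric maximum likelihood estimators,
`argmax_{g ∈ 𝒢} ℓ_n (f_g)`; it may be empty. -/
def npmleSet (p : ℝ → 𝒳 → ℝ) (Θ : Set ℝ) (n : ℕ) (x : ℕ → 𝒳) : Set (Measure ℝ) :=
  {g | g ∈ mixingClass Θ ∧ IsMaxOn (fun h => logLik (mixture p h) n x) (mixingClass Θ) g}

/-- The set `𝒢_n(c) = {g ∈ 𝒢 : ℓ_n (f_g) ≥ ℓ_n (f_{g₀}) + c} ∪ {ĝ}`, where `ĝ` is included only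
if it is a maximizer of the likelihood. -/
def likelihoodClass (p : ℝ → 𝒳 → ℝ) (Θ : Set ℝ) (g₀ : Measure ℝ) (n : ℕ) (x : ℕ → 𝒳)
    (ghat : Measure ℝ) (c : ℝ) : Set (Measure ℝ) :=
  {g | g ∈ mixingClass Θ ∧ logLik (mixture p g₀) n x + c ≤ logLik (mixture p g) n x} ∪
    ({ghat} ∩ npmleSet p Θ n x)

/-- The chi-square divergence `‖f / f₀ - 1‖²` in `L₂(f₀ dν)`, with value `∞` if the function
is not square integrable. -/
noncomputable def chiSq [MeasurableSpace 𝒳] (ν : Measure 𝒳) (f f₀ : 𝒳 → ℝ) : ℝ≥0∞ :=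
  eLpNorm (fun x => f x / f₀ x - 1) 2 (ν.withDensity fun x => ENNReal.ofReal (f₀ x)) ^ 2

/-- The supremum of `n χ²(f_g, f_{g₀})` over `𝒢_n(c)`. -/
noncomputable def supScaledChiSq [MeasurableSpace 𝒳] (p : ℝ → 𝒳 → ℝ) (ν : Measure 𝒳)
    (Θ : Set ℝ) (g₀ : Measure ℝ) (n : ℕ) (x : ℕ → 𝒳) (ghat : Measure ℝ) (c : ℝ) : ℝ≥0∞ :=
  ⨆ g ∈ likelihoodClass p Θ g₀ n x ghat c, (n : ℝ≥0∞) * chiSq ν (mixture p g) (mixture p g₀)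

/-- The likelihood ratio statistic `L_n(𝒢, g₀)`, as a supremum over `𝒢`. If the maximum
likelihood estimator `ĝ` exists, it is `2 {ℓ_n (f_ĝ) - ℓ_n (f_{g₀})}`; see
`lrStat_eq_of_mem_npmleSet`. -/
noncomputable def lrStat (p : ℝ → 𝒳 → ℝ) (Θ : Set ℝ) (g₀ : Measure ℝ) (n : ℕ) (x : ℕ → 𝒳) :
    EReal :=
  ⨆ g ∈ mixingClass Θ, ((2 * (logLik (mixture p g) n x - logLik (mixture p g₀) n x) : ℝ) : EReal)

theorem lrStat_eq_of_mem_npmleSet (p : ℝ → 𝒳 → ℝ) (Θ : Set ℝ) (g₀ : Measure ℝ) (n : ℕ)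
    (x : ℕ → 𝒳) (ghat : Measure ℝ) (h : ghat ∈ npmleSet p Θ n x) :
    lrStat p Θ g₀ n x =
      ((2 * (logLik (mixture p ghat) n x - logLik (mixture p g₀) n x) : ℝ) : EReal) := by
  refine le_antisymm (iSup₂_le fun g hg => ?_) (le_iSup₂_of_le ghat h.1 le_rfl)
  have hle : logLik (mixture p g) n x ≤ logLik (mixture p ghat) n x := h.2 hg
  exact_mod_cast (by linarith)

end Mixture

/-- `Y n → ∞` in probability: `P (Y n ≤ M) → 0` for every real `M`. As `Y n` need not be
measurable, `P` is read as outer measure here. -/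
def DivergesInProbability {Ω : Type*} [MeasurableSpace Ω] (P : Measure Ω)
    (Y : ℕ → Ω → EReal) : Prop :=
  ∀ M : ℝ, Tendsto (fun n => P {ω | Y n ω ≤ (M : EReal)}) atTop (𝓝 0)

end MixtureNPMLE

/-! In both models the likelihood ratios `p θ / p θ₀` have Gram kernel `exp (κ (θ - θ₀) (θ' - θ₀))`
in `L₂(p θ₀)`, with `κ = 1` (Gaussian) or `κ = 1 / θ₀` (Poisson). Hence the scores `p θ / p θ₀ - 1`,
normalized to unit variance, become uncorrelated as the distances of their parameters from `θ₀` grow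
and separate (`abs_exp_correlation_le`). An unbounded `Θ` thus contains arbitrarily many nearly
orthonormal scores.

By the central limit theorem, the normalized sums of `K` such scores are nearly independent standard
normals, so all stay below `T` with probability close to `Φ(T) ^ K`, which is small for large `K`
(`exists_eventually_measure_forall_score_le`).

When one sum exceeds `T`, mixing in a mass of order `T / √n` at the corresponding parameter raises
the log-likelihood by at least `T² / 16` (`le_sum_log_one_add`), while `n χ²` equals `T² / 64`
exactly. Since `T` is arbitrary, both quantities diverge. -/

namespace MixtureNPMLE

/-! ### Central limit theorem for finitely many scores -/

/-- The orthant-shaped set of vectors all of whose coordinates are at most `T`. -/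
def coordLE (ι : Type*) (T : ℝ) : Set (EuclideanSpace ℝ ι) := {z | ∀ j, z j ≤ T}

lemma isClosed_coordLE {ι : Type*} (T : ℝ) : IsClosed (coordLE ι T) := by
  rw [coordLE, Set.ofPred_forall]
  exact isClosed_iInter fun j => isClosed_le (by fun_prop) continuous_const

section CentralLimit

lemma aemeasurable_of_hasLaw {Ω 𝒳 : Type*} [MeasurableSpace Ω] [MeasurableSpace 𝒳] {X : ℕ → Ω → 𝒳} {Q : Measure 𝒳} {P : Measure Ω}
    (hlaw : ∀ i, HasLaw (X i) Q P) {f : 𝒳 → ℝ} (hf : Measurable f) (i : ℕ) :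
    AEMeasurable (fun ω => f (X i ω)) P :=
  hf.comp_aemeasurable (hlaw i).aemeasurable

variable {Ω 𝒳 ι : Type*} [MeasurableSpace Ω] [MeasurableSpace 𝒳] [Fintype ι]

/-- The normalized sums of the functions `h j` along the first `n` observations. -/
noncomputable def scoreVector (h : ι → 𝒳 → ℝ) (X : ℕ → Ω → 𝒳) (n : ℕ) (ω : Ω) :
    EuclideanSpace ℝ ι :=
  WithLp.toLp 2 fun j => (√(n : ℝ))⁻¹ * ∑ i ∈ Finset.range n, h j (X i ω)

/-- The second moment matrix of the functions `h j` under `Q`. -/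
noncomputable def gramMatrix (h : ι → 𝒳 → ℝ) (Q : Measure 𝒳) : Matrix ι ι ℝ :=
  Matrix.of fun i j => ∫ x, h i x * h j x ∂Q

lemma aemeasurable_scoreVector {X : ℕ → Ω → 𝒳} {Q : Measure 𝒳} {P : Measure Ω}
    (hlaw : ∀ i, HasLaw (X i) Q P) {h : ι → 𝒳 → ℝ} (hm : ∀ j, Measurable (h j)) (n : ℕ) :
    AEMeasurable (scoreVector h X n) P := by
  refine (WithLp.measurable_toLp 2 (ι → ℝ)).comp_aemeasurable (aemeasurable_pi_lambda _ fun j => ?_)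
  exact (Finset.aemeasurable_fun_sum _ fun i _ => aemeasurable_of_hasLaw hlaw (hm j) i).const_mul _

lemma sum_mul_gramMatrix {h : ι → 𝒳 → ℝ} {Q : Measure 𝒳} (h2 : ∀ j, MemLp (h j) 2 Q)
    (u : ι → ℝ) :
    u ⬝ᵥ (gramMatrix h Q).mulVec u = ∫ x, (∑ j, u j * h j x) ^ 2 ∂Q := by
  have hI : ∀ i j, Integrable (fun x => u i * h i x * (u j * h j x)) Q := fun i j =>
    ((h2 i).const_mul (u i)).integrable_mul ((h2 j).const_mul (u j))
  simp_rw [sq, Finset.sum_mul_sum]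
  rw [integral_finsetSum _ fun i _ => integrable_finsetSum _ fun j _ => hI i j]
  refine Finset.sum_congr rfl fun i _ => ?_
  rw [integral_finsetSum _ fun j _ => hI i j, Matrix.mulVec, dotProduct, Finset.mul_sum]
  refine Finset.sum_congr rfl fun j _ => ?_
  rw [gramMatrix, Matrix.of_apply, mul_comm _ (u j), ← mul_assoc, ← integral_const_mul]
  exact integral_congr_ae (.of_forall fun x => by ring)

lemma gramMatrix_posSemidef {h : ι → 𝒳 → ℝ} {Q : Measure 𝒳} (h2 : ∀ j, MemLp (h j) 2 Q) :
    (gramMatrix h Q).PosSemidef := by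
  refine Matrix.PosSemidef.of_dotProduct_mulVec_nonneg ?_ fun u => ?_
  · ext i j
    simp [gramMatrix, mul_comm]
  · rw [star_trivial, sum_mul_gramMatrix h2]
    exact integral_nonneg fun x => sq_nonneg _

/-- Cramér–Wold: the characteristic function at `u` is that of the normalized sum of the scalar
function `∑ j, u j * h j` at frequency 1. The scalar central limit theorem applies, and the limiting
variance is the Gram quadratic form at `u`. -/
theorem tendsto_charFun_scoreVector [DecidableEq ι] {P : Measure Ω} [IsProbabilityMeasure P]
    {Q : Measure 𝒳} {X : ℕ → Ω → 𝒳} (hindep : iIndepFun X P) (hlaw : ∀ i, HasLaw (X i) Q P)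
    {h : ι → 𝒳 → ℝ} (hm : ∀ j, Measurable (h j)) (h2 : ∀ j, MemLp (h j) 2 Q)
    (h0 : ∀ j, ∫ x, h j x ∂Q = 0) (u : EuclideanSpace ℝ ι) :
    Tendsto (fun n => charFun (P.map (scoreVector h X n)) u) atTop
      (𝓝 (charFun (multivariateGaussian 0 (gramMatrix h Q)) u)) := by
  have hQ : IsProbabilityMeasure Q := (hlaw 0).map_eq ▸
    Measure.isProbabilityMeasure_map (hlaw 0).aemeasurable
  set H : 𝒳 → ℝ := fun x => ∑ j, u j * h j x with hH
  have hHm : Measurable H := Finset.measurable_fun_sum _ fun j _ => (hm j).const_mul _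
  have hH2 : MemLp H 2 Q := memLp_finsetSum _ fun j _ => (h2 j).const_mul _
  have hH0 : ∫ x, H x ∂Q = 0 := by
    rw [integral_finsetSum _ fun j _ => (((h2 j).const_mul (u j)).integrable one_le_two)]
    simp [integral_const_mul, h0]
  have hident : ∀ i, IdentDistrib (fun ω => H (X i ω)) (fun ω => H (X 0 ω)) P P := fun i =>
    IdentDistrib.comp (f := X i) (g := X 0) ⟨(hlaw i).aemeasurable, (hlaw 0).aemeasurable,
      (hlaw i).map_eq.trans (hlaw 0).map_eq.symm⟩ hHm
  have hmean : P[fun ω => H (X 0 ω)] = 0 := by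
    rw [← hH0, ← (hlaw 0).integral_comp hHm.aestronglyMeasurable]; rfl
  have hvar : Var[fun ω => H (X 0 ω); P] = ∫ x, H x ^ 2 ∂Q := by
    rw [variance_of_integral_eq_zero (hident 0).aemeasurable_fst hmean,
      ← (hlaw 0).integral_comp (hHm.pow_const 2).aestronglyMeasurable]
    rfl
  have hL2 : MemLp (fun ω => H (X 0 ω)) 2 P := by
    have := hH2
    rw [← (hlaw 0).map_eq] at this
    exact (memLp_map_measure_iff hHm.aestronglyMeasurable (hlaw 0).aemeasurable).1 this
  have key := tendstoInDistribution_inv_sqrt_mul_sum_sub (P := P)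
    (X := fun i ω => H (X i ω)) (Y := id) ⟨aemeasurable_id, Measure.map_id⟩ hL2
    (hindep.comp (fun _ => H) fun _ => hHm) hident
  have key' := ProbabilityMeasure.tendsto_iff_tendsto_charFun.1 key.tendsto 1
  simp only [ProbabilityMeasure.coe_mk, Measure.map_id] at key'
  have hlim : charFun (gaussianReal 0 (Var[fun ω => H (X 0 ω); P]).toNNReal) 1 =
      charFun (multivariateGaussian 0 (gramMatrix h Q)) u := by
    rw [charFun_gaussianReal, charFun_multivariateGaussian (gramMatrix_posSemidef h2),
      sum_mul_gramMatrix h2, ← hvar, Real.coe_toNNReal _ (variance_nonneg _ _)]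
    simp
  rw [hlim] at key'
  refine key'.congr fun n => ?_
  rw [charFun_apply, charFun_apply, integral_map (key.forall_aemeasurable n) (by fun_prop),
    integral_map (aemeasurable_scoreVector hlaw hm n) (by fun_prop)]
  refine integral_congr_ae (.of_forall fun ω => ?_)
  have : inner ℝ (scoreVector h X n ω) u =
      (√(n : ℝ))⁻¹ * (∑ i ∈ Finset.range n, H (X i ω) - n * P[fun ω => H (X 0 ω)]) := by
    rw [hmean, mul_zero, sub_zero, PiLp.inner_apply, hH, Finset.sum_comm, Finset.mul_sum]
    refine Finset.sum_congr rfl fun j _ => ?_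
    simp only [scoreVector, RCLike.inner_apply, conj_trivial, ← Finset.mul_sum]
    ring
  simp only [this]
  simp

theorem tendsto_charFun_multivariateGaussian [DecidableEq ι] {S : ℕ → Matrix ι ι ℝ}
    (hS : ∀ m, (S m).PosSemidef) (hlim : ∀ i j, Tendsto (fun m => S m i j) atTop
      (𝓝 ((1 : Matrix ι ι ℝ) i j))) (u : EuclideanSpace ℝ ι) :
    Tendsto (fun m => charFun (multivariateGaussian 0 (S m)) u) atTop
      (𝓝 (charFun (multivariateGaussian 0 (1 : Matrix ι ι ℝ)) u)) := by
  simp_rw [charFun_multivariateGaussian (hS _), charFun_multivariateGaussian Matrix.PosSemidef.one]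
  have : Tendsto (fun m => u.ofLp ⬝ᵥ (S m).mulVec u.ofLp) atTop
      (𝓝 (u.ofLp ⬝ᵥ (1 : Matrix ι ι ℝ).mulVec u.ofLp)) := by
    simp only [dotProduct, Matrix.mulVec]
    exact tendsto_finsetSum _ fun i _ => (tendsto_finsetSum _ fun j _ =>
      (hlim i j).mul_const _).const_mul _
  refine (Complex.continuous_exp.tendsto _).comp (tendsto_const_nhds.sub ?_)
  exact ((Complex.continuous_ofReal.tendsto _).comp this).div_const 2

lemma multivariateGaussian_coordLE [DecidableEq ι] (T : ℝ) :
    multivariateGaussian 0 (1 : Matrix ι ι ℝ) (coordLE ι T) =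
      gaussianReal 0 1 (Set.Iic T) ^ Fintype.card ι := by
  rw [multivariateGaussian_zero_one, ← map_pi_eq_stdGaussian,
    Measure.map_apply (WithLp.measurable_toLp 2 (ι → ℝ)) (isClosed_coordLE T).measurableSet]
  have : WithLp.toLp 2 ⁻¹' coordLE ι T = Set.univ.pi fun _ : ι => Set.Iic T := by
    ext x; simp [coordLE, Pi.le_def]
  rw [this, Measure.pi_pi]
  simp

end CentralLimit

/-! ### Large maxima of nearly orthonormal scores -/

lemma gaussianReal_Iic_lt_one (T : ℝ) : gaussianReal 0 1 (Set.Iic T) < 1 := by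
  refine lt_of_le_of_ne prob_le_one fun h => ?_
  rw [← prob_compl_eq_zero_iff measurableSet_Iic, Set.compl_Iic] at h
  have := gaussianReal_absolutelyContinuous' 0 one_ne_zero h
  simp at this

/-- The parameters are chosen in the order `K`, `m`, `n`: `K` makes `Φ(T) ^ K` small, `m` brings the
Gram matrix of `K` consecutive scores close to the identity, and `n` enters last through the central
limit theorem. Each limit passes to the closed set `coordLE` by the portmanteau theorem. -/
theorem exists_eventually_measure_forall_score_le {Ω 𝒳 : Type*} [MeasurableSpace Ω]
    [MeasurableSpace 𝒳] {P : Measure Ω} [IsProbabilityMeasure P] {Q : Measure 𝒳}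
    {X : ℕ → Ω → 𝒳} (hindep : iIndepFun X P) (hlaw : ∀ i, HasLaw (X i) Q P)
    {h : ℕ → 𝒳 → ℝ} (hm : ∀ j, Measurable (h j)) (h2 : ∀ j, MemLp (h j) 2 Q)
    (h0 : ∀ j, ∫ x, h j x ∂Q = 0) (h1 : ∀ j, ∫ x, h j x * h j x ∂Q = 1)
    (hcorr : ∀ i j, i ≠ j → Tendsto (fun m => ∫ x, h (m + i) x * h (m + j) x ∂Q) atTop (𝓝 0))
    (T : ℝ) {η : ℝ≥0∞} (hη : η ≠ 0) :
    ∃ K m : ℕ, ∀ᶠ n : ℕ in atTop,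
      P {ω | ∀ j : Fin K, (√(n : ℝ))⁻¹ * ∑ i ∈ Finset.range n, h (m + j) (X i ω) ≤ T} < η := by
  obtain ⟨K, hK⟩ := ((ENNReal.tendsto_pow_atTop_nhds_zero_of_lt_one
    (gaussianReal_Iic_lt_one T)).eventually_lt_const hη.bot_lt).exists
  let g : ℕ → Fin K → 𝒳 → ℝ := fun m j => h (m + j)
  let ν (m : ℕ) : ProbabilityMeasure (EuclideanSpace ℝ (Fin K)) :=
    ⟨multivariateGaussian 0 (gramMatrix (g m) Q), inferInstance⟩
  have hlim : Tendsto ν atTop (𝓝 ⟨multivariateGaussian 0 1, inferInstance⟩) := by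
    refine ProbabilityMeasure.tendsto_of_tendsto_charFun fun u =>
      tendsto_charFun_multivariateGaussian (S := fun m => gramMatrix (g m) Q)
        (fun m => gramMatrix_posSemidef fun j => h2 _) (fun i j => ?_) u
    by_cases hij : i = j
    · subst hij
      simp [gramMatrix, g, h1]
    · simpa [hij, gramMatrix, g] using hcorr i j (by simpa [Fin.ext_iff] using hij)
  have hlt := (ProbabilityMeasure.limsup_measure_closed_le_of_tendsto hlim
    (isClosed_coordLE T)).trans_lt
    ((multivariateGaussian_coordLE (ι := Fin K) T).trans_lt (by simpa using hK))
  obtain ⟨m, hmη⟩ := (eventually_lt_of_limsup_lt hlt).exists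
  refine ⟨K, m, ?_⟩
  have hZ := aemeasurable_scoreVector hlaw (h := g m) fun j => hm _
  let ρ (n : ℕ) : ProbabilityMeasure (EuclideanSpace ℝ (Fin K)) :=
    ⟨P.map (scoreVector (g m) X n), Measure.isProbabilityMeasure_map (hZ n)⟩
  have hρ : Tendsto ρ atTop (𝓝 (ν m)) := ProbabilityMeasure.tendsto_of_tendsto_charFun fun u =>
    tendsto_charFun_scoreVector hindep hlaw (fun j => hm _) (fun j => h2 _) (fun j => h0 _) u
  have hlt' := (ProbabilityMeasure.limsup_measure_closed_le_of_tendsto hρ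
    (isClosed_coordLE T)).trans_lt hmη
  filter_upwards [eventually_lt_of_limsup_lt hlt'] with n hn
  have hn' : P.map (scoreVector (g m) X n) (coordLE (Fin K) T) < η := hn
  rwa [Measure.map_apply_of_aemeasurable (hZ n) (isClosed_coordLE T).measurableSet] at hn'

/-! ### Likelihood gain from a large score -/

lemma sub_two_mul_sq_le_log_one_add {u : ℝ} (hu : -(1 / 2) ≤ u) :
    u - 2 * u ^ 2 ≤ Real.log (1 + u) := by
  rcases le_total 0 u with h | h
  · have h1 := Real.one_sub_inv_le_log_of_pos (show 0 < 1 + u by linarith)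
    refine le_trans ?_ h1
    have h2 : 1 - (1 + u)⁻¹ = u / (1 + u) := by field_simp; ring
    rw [h2, le_div_iff₀ (by linarith)]
    nlinarith [mul_nonneg h (sq_nonneg u), sq_nonneg u]
  · have h1 := Real.abs_log_sub_add_sum_range_le (x := -u)
      (by rw [abs_neg, abs_of_nonpos h]; linarith) 1
    simp only [Finset.sum_range_one, zero_add, pow_one, Nat.cast_zero, div_one, sub_neg_eq_add,
      abs_neg] at h1
    have h2 : |u| ^ (1 + 1) / (1 - |u|) ≤ 2 * u ^ 2 := by
      rw [abs_of_nonpos h, div_le_iff₀ (by linarith)]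
      change (-u) ^ 2 ≤ _
      nlinarith [mul_nonneg (sq_nonneg u) (show 0 ≤ 1 / 2 + u by linarith)]
    have := (abs_le.1 (h1.trans h2)).1
    linarith

/-- Only a lower bound on `y` is needed for the quadratic minorant of the logarithm, so scores
unbounded above are allowed. A step `a T / √n` gains at least `(a - 4 a²) T²`, which is largest at
`a = 1 / 8`. -/
lemma le_sum_log_one_add {n : ℕ} (hn : 0 < n) {T b : ℝ} (hT : 0 < T) {y : ℕ → ℝ}
    (hb : ∀ i, -b ≤ y i) (hbn : T / 8 / √(n : ℝ) * b ≤ 1 / 2)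
    (hsum : T ≤ (√(n : ℝ))⁻¹ * ∑ i ∈ Finset.range n, y i)
    (hsq : (∑ i ∈ Finset.range n, y i ^ 2) / n ≤ 2) :
    T ^ 2 / 16 ≤ ∑ i ∈ Finset.range n, Real.log (1 + T / 8 / √(n : ℝ) * y i) := by
  have hn' : (0 : ℝ) < n := by exact_mod_cast hn
  have hc : 0 < T / 8 / √(n : ℝ) := by positivity
  have h1 : ∑ i ∈ Finset.range n, (T / 8 / √(n : ℝ) * y i - 2 * (T / 8 / √(n : ℝ) * y i) ^ 2) ≤
      ∑ i ∈ Finset.range n, Real.log (1 + T / 8 / √(n : ℝ) * y i) :=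
    Finset.sum_le_sum fun i _ => sub_two_mul_sq_le_log_one_add (by nlinarith [hb i])
  refine le_trans ?_ h1
  have h2 : ∑ i ∈ Finset.range n, (T / 8 / √(n : ℝ) * y i - 2 * (T / 8 / √(n : ℝ) * y i) ^ 2) =
      T / 8 * ((√(n : ℝ))⁻¹ * ∑ i ∈ Finset.range n, y i) -
        T ^ 2 / 32 * ((∑ i ∈ Finset.range n, y i ^ 2) / n) := by
    rw [Finset.sum_sub_distrib, ← Finset.mul_sum, ← Finset.mul_sum]
    simp_rw [mul_pow, div_pow, Real.sq_sqrt hn'.le, ← Finset.mul_sum]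
    ring
  rw [h2]
  nlinarith [sq_nonneg T]

lemma tendsto_measure_two_lt_average_sq {Ω 𝒳 : Type*} [MeasurableSpace Ω]
    [MeasurableSpace 𝒳] {P : Measure Ω} [IsProbabilityMeasure P] {Q : Measure 𝒳}
    {X : ℕ → Ω → 𝒳} (hindep : iIndepFun X P) (hlaw : ∀ i, HasLaw (X i) Q P)
    {f : 𝒳 → ℝ} (hm : Measurable f) (h2 : MemLp f 2 Q) (h1 : ∫ x, f x * f x ∂Q = 1) :
    Tendsto (fun n : ℕ => P {ω | 2 < (∑ i ∈ Finset.range n, f (X i ω) ^ 2) / n}) atTop (𝓝 0) := by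
  have hf : Measurable fun x => f x ^ 2 := hm.pow_const 2
  have hint : Integrable (fun ω => f (X 0 ω) ^ 2) P := by
    have := h2.integrable_sq
    rw [← (hlaw 0).map_eq] at this
    exact (integrable_map_measure hf.aestronglyMeasurable (hlaw 0).aemeasurable).1 this
  have hmean : P[fun ω => f (X 0 ω) ^ 2] = 1 := by
    rw [← h1]
    simp_rw [← sq]
    exact (hlaw 0).integral_comp hf.aestronglyMeasurable
  have hslln := strong_law_ae_real (fun i ω => f (X i ω) ^ 2) hint
    (fun i j hij => (hindep.indepFun hij).comp hf hf) fun i =>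
      IdentDistrib.comp (f := X i) (g := X 0) ⟨(hlaw i).aemeasurable, (hlaw 0).aemeasurable,
        (hlaw i).map_eq.trans (hlaw 0).map_eq.symm⟩ hf
  rw [hmean] at hslln
  have hmeas := tendstoInMeasure_of_tendsto_ae (μ := P) (g := fun _ => (1 : ℝ)) (fun n => by
    exact ((Finset.aemeasurable_fun_sum _ fun i _ =>
      aemeasurable_of_hasLaw hlaw hf i).div_const _).aestronglyMeasurable) hslln
  -- The averages converge to 1, so exceeding 2 is a deviation of at least 1.
  refine tendsto_of_tendsto_of_tendsto_of_le_of_le tendsto_const_nhds (hmeas 1 one_pos)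
    (fun n => zero_le) fun n => measure_mono fun ω hω => ?_
  have hω' : 2 < (∑ i ∈ Finset.range n, f (X i ω) ^ 2) / n := hω
  change 1 ≤ edist _ _
  rw [edist_dist, ENNReal.one_le_ofReal, Real.dist_eq]
  exact le_trans (by linarith) (le_abs_self _)

theorem exists_eventually_measure_sum_log_lt {Ω 𝒳 : Type*} [MeasurableSpace Ω]
    [MeasurableSpace 𝒳] {P : Measure Ω} [IsProbabilityMeasure P] {Q : Measure 𝒳}
    {X : ℕ → Ω → 𝒳} (hindep : iIndepFun X P) (hlaw : ∀ i, HasLaw (X i) Q P)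
    {h : ℕ → 𝒳 → ℝ} (hm : ∀ j, Measurable (h j)) (h2 : ∀ j, MemLp (h j) 2 Q)
    (h0 : ∀ j, ∫ x, h j x ∂Q = 0) (h1 : ∀ j, ∫ x, h j x * h j x ∂Q = 1)
    (hcorr : ∀ i j, i ≠ j → Tendsto (fun m => ∫ x, h (m + i) x * h (m + j) x ∂Q) atTop (𝓝 0))
    {b : ℕ → ℝ} (hb : ∀ j x, -b j ≤ h j x) {T : ℝ} (hT : 0 < T) {η : ℝ≥0∞} (hη : η ≠ 0) :
    ∃ N : ℕ, ∀ᶠ n : ℕ in atTop, P {ω | ∀ j < N,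
      ∑ i ∈ Finset.range n, Real.log (1 + T / 8 / √(n : ℝ) * h j (X i ω)) < T ^ 2 / 16} < η := by
  obtain ⟨K, m, hKm⟩ := exists_eventually_measure_forall_score_le hindep hlaw hm h2 h0 h1 hcorr T
    (ENNReal.half_pos hη).ne'
  have hbad : Tendsto (fun n : ℕ => ∑ j ∈ Finset.range (m + K),
      P {ω | 2 < (∑ i ∈ Finset.range n, h j (X i ω) ^ 2) / n}) atTop (𝓝 0) := by
    simpa using tendsto_finsetSum (Finset.range (m + K)) fun j _ =>
      tendsto_measure_two_lt_average_sq hindep hlaw (hm j) (h2 j) (h1 j)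
  have hsmall : ∀ᶠ n : ℕ in atTop, ∀ j ∈ Finset.range (m + K),
      T / 8 / √(n : ℝ) * b j ≤ 1 / 2 := by
    rw [eventually_all_finset]
    intro j _
    have : Tendsto (fun n : ℕ => T / 8 / √(n : ℝ) * b j) atTop (𝓝 (0 * b j)) :=
      ((Real.tendsto_sqrt_atTop.comp tendsto_natCast_atTop_atTop).const_div_atTop _).mul_const _
    rw [zero_mul] at this
    exact this.eventually_le_const (by norm_num)
  refine ⟨m + K, ?_⟩
  filter_upwards [hKm, hbad.eventually_lt_const (ENNReal.half_pos hη), hsmall,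
    eventually_gt_atTop 0] with n hn1 hn2 hn3 hn
  rw [← ENNReal.add_halves η]
  refine lt_of_le_of_lt ?_ (ENNReal.add_lt_add hn1 hn2)
  refine le_trans (measure_mono fun ω hω => ?_) ((measure_union_le _ _).trans
    (add_le_add le_rfl (measure_biUnion_finset_le (Finset.range (m + K)) _)))
  -- Outside both exceptional events some score sum exceeds `T` and its empirical second moment is
  -- at most 2, which forces the likelihood gain.
  by_contra hcon
  simp only [Set.mem_union, Set.mem_ofPred_eq, Set.mem_iUnion, not_or, not_forall, not_le,
    not_exists, not_lt, exists_prop, not_and] at hcon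
  obtain ⟨⟨j, hj⟩, hsq⟩ := hcon
  have hjN : m + (j : ℕ) < m + K := by omega
  exact (hω _ hjN).not_ge (le_sum_log_one_add hn hT (fun i => hb _ (X i ω))
    (hn3 _ (Finset.mem_range.2 hjN)) hj.le (hsq _ (Finset.mem_range.2 hjN)))

/-! ### Spread-out parameters and decay of correlations -/

lemma mixture_dirac {𝒳 : Type*} (p : ℝ → 𝒳 → ℝ) (θ : ℝ) : mixture p (Measure.dirac θ) = p θ := by
  ext x
  simp [mixture]

lemma exists_spread_seq {Θ : Set ℝ} (hΘ : ¬ Bornology.IsBounded Θ) (θ₀ D : ℝ) :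
    ∃ u : ℕ → ℝ, (∀ j, u j ∈ Θ) ∧ (∀ j, D ≤ |u j - θ₀|) ∧
      ∀ m i j, i < j → |u (m + i) - θ₀| + m ≤ |u (m + j) - θ₀| := by
  have hex : ∀ B : ℝ, ∃ θ ∈ Θ, B ≤ |θ - θ₀| := by
    intro B
    by_contra! hcon
    exact hΘ (Metric.isBounded_iff_subset_closedBall θ₀ |>.2
      ⟨B, fun θ hθ => Metric.mem_closedBall.2 (hcon θ hθ).le⟩)
  choose g hgΘ hg using hex
  -- The gap required at step `k` is `k` itself, so any two terms of index at least `m` have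
  -- distances to `θ₀` differing by at least `m`.
  let u : ℕ → ℝ := fun n => Nat.rec (g D) (fun k t => g (|t - θ₀| + k)) n
  have hstep : ∀ n, |u n - θ₀| + n ≤ |u (n + 1) - θ₀| := fun n => hg _
  have hmono : Monotone fun n => |u n - θ₀| := monotone_nat_of_le_succ fun n =>
    (le_add_of_nonneg_right n.cast_nonneg).trans (hstep n)
  refine ⟨u, fun j => ?_, fun j => (hg D).trans (hmono j.zero_le), fun m i j hij => ?_⟩
  · cases j with
    | zero => exact hgΘ _
    | succ n => exact hgΘ _
  · have h1 := hstep (m + i)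
    have h2 : |u (m + i + 1) - θ₀| ≤ |u (m + j) - θ₀| := hmono (show m + i + 1 ≤ m + j by omega)
    push_cast at h1
    have : (0 : ℝ) ≤ i := i.cast_nonneg
    linarith

lemma exp_div_two_le_sqrt {a : ℝ} (ha : 1 ≤ a) : Real.exp (a / 2) / 2 ≤ √(Real.exp a - 1) := by
  refine Real.le_sqrt_of_sq_le ?_
  have h1 : Real.exp (a / 2) ^ 2 = Real.exp a := by rw [← Real.exp_nat_mul]; congr 1; ring
  have := Real.add_one_le_exp a
  rw [div_pow, h1]
  linarith

/-- Completing the square: `κ |x| |y| - κ x² / 2 - κ y² / 2 = -(κ / 2) (|x| - |y|)²`. Absolute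
values cover parameters on opposite sides of `θ₀`; the 4 comes from the two halves in
`exp_div_two_le_sqrt`. -/
lemma abs_exp_correlation_le {κ x y m : ℝ} (hκ : 0 < κ) (hx : 1 ≤ κ * x ^ 2) (hy : 1 ≤ κ * y ^ 2)
    (hm : 0 ≤ m) (hxy : m ≤ |(|x| - |y|)|) :
    |(Real.exp (κ * x * y) - 1) / (√(Real.exp (κ * x ^ 2) - 1) * √(Real.exp (κ * y ^ 2) - 1))| ≤
      4 * Real.exp (-(κ / 2 * m ^ 2)) := by
  have hsx := exp_div_two_le_sqrt hx
  have hsy := exp_div_two_le_sqrt hy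
  have hnum : |Real.exp (κ * x * y) - 1| ≤ Real.exp (κ * (|x| * |y|)) := by
    have h1 : κ * x * y ≤ κ * (|x| * |y|) := by
      rw [mul_assoc, ← abs_mul]; exact mul_le_mul_of_nonneg_left (le_abs_self _) hκ.le
    have h2 : 1 ≤ Real.exp (κ * (|x| * |y|)) := Real.one_le_exp (by positivity)
    have h3 := Real.exp_le_exp.2 h1
    rw [abs_le]
    constructor <;> linarith [Real.exp_pos (κ * x * y)]
  rw [abs_div, abs_of_nonneg (mul_nonneg (Real.sqrt_nonneg _) (Real.sqrt_nonneg _)),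
    div_le_iff₀ (mul_pos (lt_of_lt_of_le (by positivity) hsx) (lt_of_lt_of_le (by positivity) hsy))]
  refine hnum.trans ?_
  have hprod : Real.exp (κ * x ^ 2 / 2) / 2 * (Real.exp (κ * y ^ 2 / 2) / 2) ≤
      √(Real.exp (κ * x ^ 2) - 1) * √(Real.exp (κ * y ^ 2) - 1) :=
    mul_le_mul hsx hsy (by positivity) (Real.sqrt_nonneg _)
  refine le_trans ?_ (mul_le_mul_of_nonneg_left hprod (by positivity))
  have : 4 * Real.exp (-(κ / 2 * m ^ 2)) *
      (Real.exp (κ * x ^ 2 / 2) / 2 * (Real.exp (κ * y ^ 2 / 2) / 2)) =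
      Real.exp (-(κ / 2 * m ^ 2) + κ * x ^ 2 / 2 + κ * y ^ 2 / 2) := by
    rw [Real.exp_add, Real.exp_add]; ring
  rw [this, Real.exp_le_exp]
  have hsq : m ^ 2 ≤ (|x| - |y|) ^ 2 := by
    rw [← sq_abs (|x| - |y|)]; exact pow_le_pow_left₀ hm hxy 2
  nlinarith [sq_abs x, sq_abs y, mul_le_mul_of_nonneg_left hsq hκ.le]

/-! ### Two-point mixtures -/

/-- The two-point mixing distribution `(1 - ε) δ_{θ₀} + ε δ_θ`. -/
noncomputable def twoPoint (ε θ₀ θ : ℝ) : Measure ℝ :=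
  ENNReal.ofReal (1 - ε) • Measure.dirac θ₀ + ENNReal.ofReal ε • Measure.dirac θ

lemma twoPoint_mem_mixingClass {Θ : Set ℝ} {ε θ₀ θ : ℝ} (h0 : 0 ≤ ε) (h1 : ε ≤ 1) (hθ₀ : θ₀ ∈ Θ)
    (hθ : θ ∈ Θ) : twoPoint ε θ₀ θ ∈ mixingClass Θ := by
  refine ⟨⟨?_⟩, ?_⟩
  · simp [twoPoint, ← ENNReal.ofReal_add (sub_nonneg.2 h1) h0]
  · simp [twoPoint, hθ₀, hθ]

section TwoPoint

variable {𝒳 : Type*} {p : ℝ → 𝒳 → ℝ}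

lemma mixture_twoPoint {ε θ₀ θ : ℝ} (h0 : 0 ≤ ε) (h1 : ε ≤ 1) (x : 𝒳) :
    mixture p (twoPoint ε θ₀ θ) x = (1 - ε) * p θ₀ x + ε * p θ x := by
  have hI : ∀ (c : ℝ) (t : ℝ), Integrable (fun θ => p θ x) (ENNReal.ofReal c • Measure.dirac t) :=
    fun c t => (integrable_dirac (by simp)).smul_measure ENNReal.ofReal_ne_top
  rw [mixture, twoPoint, integral_add_measure (hI _ _) (hI _ _), integral_smul_measure,
    integral_smul_measure, integral_dirac, integral_dirac, ENNReal.toReal_ofReal h0,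
    ENNReal.toReal_ofReal (sub_nonneg.2 h1), smul_eq_mul, smul_eq_mul]

lemma logLik_twoPoint_sub {ε θ₀ θ : ℝ} (h0 : 0 ≤ ε) (h1 : ε < 1) (hp0 : ∀ x, 0 < p θ₀ x)
    (hp : ∀ x, 0 ≤ p θ x) (n : ℕ) (x : ℕ → 𝒳) :
    logLik (mixture p (twoPoint ε θ₀ θ)) n x - logLik (mixture p (Measure.dirac θ₀)) n x =
      ∑ i ∈ Finset.range n, Real.log (1 + ε * (p θ (x i) / p θ₀ (x i) - 1)) := by
  rw [logLik, logLik, ← Finset.sum_sub_distrib, mixture_dirac]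
  refine Finset.sum_congr rfl fun i _ => ?_
  have h := hp0 (x i)
  rw [mixture_twoPoint h0 h1.le, ← Real.log_div _ h.ne']
  · congr 1
    field_simp
    ring
  -- Strictness of `ε < 1` keeps the mixture density positive, even where `p θ` vanishes.
  · nlinarith [mul_pos (sub_pos.2 h1) h, mul_nonneg h0 (hp (x i))]

lemma chiSq_twoPoint [MeasurableSpace 𝒳] (ν : Measure 𝒳) {ε θ₀ θ : ℝ} (h0 : 0 ≤ ε) (h1 : ε ≤ 1)
    (hp0 : ∀ x, 0 < p θ₀ x)
    (hint : Integrable (fun x => (p θ x / p θ₀ x - 1) ^ 2)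
      (ν.withDensity fun x => ENNReal.ofReal (mixture p (Measure.dirac θ₀) x))) :
    chiSq ν (mixture p (twoPoint ε θ₀ θ)) (mixture p (Measure.dirac θ₀)) =
      ENNReal.ofReal (ε ^ 2 * ∫ x, (p θ x / p θ₀ x - 1) ^ 2
        ∂(ν.withDensity fun x => ENNReal.ofReal (mixture p (Measure.dirac θ₀) x))) := by
  rw [chiSq, ← integral_const_mul,
    ofReal_integral_eq_lintegral_ofReal (hint.const_mul _) (.of_forall fun x => by positivity),
    show (2 : ℝ≥0∞) = ((2 : NNReal) : ℝ≥0∞) by simp,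
    ← ENNReal.rpow_two, ← NNReal.coe_two, eLpNorm_nnreal_pow_eq_lintegral two_ne_zero]
  refine lintegral_congr fun x => ?_
  have hx := (hp0 x).ne'
  rw [mixture_twoPoint h0 h1, mixture_dirac, NNReal.coe_two, ENNReal.rpow_two,
    ← ofReal_norm, ← ENNReal.ofReal_pow (norm_nonneg _), Real.norm_eq_abs, sq_abs]
  congr 1
  field_simp
  ring

end TwoPoint

/-! ### Divergence from an exponential kernel -/

/-- The likelihood ratios `p_θ / p_{θ₀}`, `θ ∈ Θ`, have the exponential Gram kernel
`exp (κ (θ - θ₀) (θ' - θ₀))` in `L₂(p_{θ₀} dν)`. -/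
def HasExponentialKernel {𝒳 : Type*} [MeasurableSpace 𝒳] (ν : Measure 𝒳) (p : ℝ → 𝒳 → ℝ)
    (Θ : Set ℝ) (θ₀ κ : ℝ) : Prop :=
  ∀ θ ∈ Θ, ∀ θ' ∈ Θ, ∫ x, p θ x / p θ₀ x * (p θ' x / p θ₀ x)
    ∂(ν.withDensity fun x => ENNReal.ofReal (mixture p (Measure.dirac θ₀) x)) =
      Real.exp (κ * (θ - θ₀) * (θ' - θ₀))

section Kernel

variable {𝒳 : Type*} [MeasurableSpace 𝒳] {ν : Measure 𝒳} {p : ℝ → 𝒳 → ℝ} {Θ : Set ℝ} {θ₀ κ : ℝ}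

lemma HasExponentialKernel.memLp (hker : HasExponentialKernel ν p Θ θ₀ κ)
    (hpm : ∀ θ, Measurable (p θ)) {θ : ℝ} (hθ : θ ∈ Θ) :
    MemLp (fun x => p θ x / p θ₀ x) 2
      (ν.withDensity fun x => ENNReal.ofReal (mixture p (Measure.dirac θ₀) x)) := by
  -- The Bochner integral of a non-integrable function is 0, so the nonzero kernel value on the
  -- diagonal already gives square integrability.
  refine (memLp_two_iff_integrable_sq (f := fun x => p θ x / p θ₀ x)
    ((hpm θ).div (hpm θ₀)).aestronglyMeasurable).2 (.of_integral_ne_zero ?_)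
  simp_rw [sq]
  rw [hker θ hθ θ hθ]
  exact Real.exp_ne_zero _

lemma HasExponentialKernel.integral_ratio (hker : HasExponentialKernel ν p Θ θ₀ κ)
    (hp0 : ∀ x, 0 < p θ₀ x) (hθ₀ : θ₀ ∈ Θ) {θ : ℝ} (hθ : θ ∈ Θ) :
    ∫ x, p θ x / p θ₀ x
      ∂(ν.withDensity fun x => ENNReal.ofReal (mixture p (Measure.dirac θ₀) x)) = 1 := by
  have h := hker θ hθ θ₀ hθ₀
  simpa [div_self (hp0 _).ne'] using h

lemma HasExponentialKernel.integral_sub_one_mul_sub_one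
    (hker : HasExponentialKernel ν p Θ θ₀ κ) (hpm : ∀ θ, Measurable (p θ))
    (hp0 : ∀ x, 0 < p θ₀ x) (hθ₀ : θ₀ ∈ Θ)
    [IsProbabilityMeasure (ν.withDensity fun x => ENNReal.ofReal (mixture p (Measure.dirac θ₀) x))]
    {θ θ' : ℝ} (hθ : θ ∈ Θ) (hθ' : θ' ∈ Θ) :
    ∫ x, (p θ x / p θ₀ x - 1) * (p θ' x / p θ₀ x - 1)
      ∂(ν.withDensity fun x => ENNReal.ofReal (mixture p (Measure.dirac θ₀) x)) =
        Real.exp (κ * (θ - θ₀) * (θ' - θ₀)) - 1 := by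
  have h1 := (hker.memLp hpm hθ)
  have h2 := (hker.memLp hpm hθ')
  set Q := ν.withDensity fun x => ENNReal.ofReal (mixture p (Measure.dirac θ₀) x)
  have h12 : Integrable (fun x => p θ x / p θ₀ x * (p θ' x / p θ₀ x)) Q := h1.integrable_mul h2
  have h1i := h1.integrable one_le_two
  have h2i := h2.integrable one_le_two
  have heq : ∀ x, (p θ x / p θ₀ x - 1) * (p θ' x / p θ₀ x - 1) =
      (p θ x / p θ₀ x * (p θ' x / p θ₀ x) - p θ x / p θ₀ x) - (p θ' x / p θ₀ x - 1) :=
    fun x => by ring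
  simp_rw [heq]
  have hA : Integrable (fun x => p θ x / p θ₀ x * (p θ' x / p θ₀ x) - p θ x / p θ₀ x) Q :=
    h12.sub h1i
  have hB : Integrable (fun x => p θ' x / p θ₀ x - 1) Q := h2i.sub (integrable_const 1)
  rw [integral_sub hA hB, integral_sub h12 h1i,
    integral_sub h2i (integrable_const 1), hker θ hθ θ' hθ', hker.integral_ratio hp0 hθ₀ hθ,
    hker.integral_ratio hp0 hθ₀ hθ']
  simp

theorem HasExponentialKernel.eventually_measure_lt {Ω : Type*} [MeasurableSpace Ω] {P : Measure Ω}
    [IsProbabilityMeasure P] (hker : HasExponentialKernel ν p Θ θ₀ κ) (hκ : 0 < κ)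
    (hpm : ∀ θ, Measurable (p θ)) (hp0 : ∀ x, 0 < p θ₀ x) (hp : ∀ θ ∈ Θ, ∀ x, 0 ≤ p θ x)
    (hΘ : ¬ Bornology.IsBounded Θ) (hθ₀ : θ₀ ∈ Θ) {X : ℕ → Ω → 𝒳} (hindep : iIndepFun X P)
    (hlaw : ∀ i, HasLaw (X i)
      (ν.withDensity fun x => ENNReal.ofReal (mixture p (Measure.dirac θ₀) x)) P)
    {T : ℝ} (hT : 0 < T) {η : ℝ≥0∞} (hη : η ≠ 0) :
    ∀ᶠ n : ℕ in atTop, P {ω | ¬ ∃ g ∈ mixingClass Θ,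
      T ^ 2 / 16 ≤ logLik (mixture p g) n (fun i => X i ω) -
        logLik (mixture p (Measure.dirac θ₀)) n (fun i => X i ω) ∧
      (n : ℝ≥0∞) * chiSq ν (mixture p g) (mixture p (Measure.dirac θ₀)) =
        ENNReal.ofReal (T ^ 2 / 64)} < η := by
  set Q := ν.withDensity fun x => ENNReal.ofReal (mixture p (Measure.dirac θ₀) x) with hQdef
  have hQ : IsProbabilityMeasure Q := (hlaw 0).map_eq ▸
    Measure.isProbabilityMeasure_map (hlaw 0).aemeasurable
  -- Distance at least `max 1 (1 / κ)` from `θ₀` ensures `κ (u j - θ₀)² ≥ 1`, as the correlation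
  -- bound requires.
  obtain ⟨u, huΘ, huD, hu⟩ := exists_spread_seq hΘ θ₀ (max 1 (1 / κ))
  have hκu : ∀ j, 1 ≤ κ * (u j - θ₀) ^ 2 := fun j => by
    have h1 := (le_max_left _ _).trans (huD j)
    have h2 := (le_max_right _ _).trans (huD j)
    rw [div_le_iff₀ hκ] at h2
    rw [← sq_abs]
    nlinarith
  set s : ℕ → ℝ := fun j => √(Real.exp (κ * (u j - θ₀) ^ 2) - 1) with hs
  have hexp : ∀ j, 0 < Real.exp (κ * (u j - θ₀) ^ 2) - 1 := fun j =>
    sub_pos.2 (Real.one_lt_exp_iff.2 (one_pos.trans_le (hκu j)))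
  have hspos : ∀ j, 0 < s j := fun j => Real.sqrt_pos.2 (hexp j)
  have hssq : ∀ j, s j ^ 2 = Real.exp (κ * (u j - θ₀) ^ 2) - 1 := fun j => Real.sq_sqrt (hexp j).le
  let h : ℕ → 𝒳 → ℝ := fun j x => (p (u j) x / p θ₀ x - 1) / s j
  have hgram : ∀ i j, ∫ x, h i x * h j x ∂Q =
      (Real.exp (κ * (u i - θ₀) * (u j - θ₀)) - 1) / (s i * s j) := fun i j => by
    rw [← hker.integral_sub_one_mul_sub_one hpm hp0 hθ₀ (huΘ i) (huΘ j), ← integral_div]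
    exact integral_congr_ae (.of_forall fun x => by simp only [h]; rw [div_mul_div_comm])
  have hm : ∀ j, Measurable (h j) := fun j =>
    (((hpm (u j)).div (hpm θ₀)).sub_const 1).div_const _
  have hsub2 : ∀ j, MemLp (fun x => p (u j) x / p θ₀ x - 1) 2 Q := fun j =>
    (hker.memLp hpm (huΘ j)).sub (memLp_const 1)
  have h2 : ∀ j, MemLp (h j) 2 Q := fun j => by
    simpa [h, div_eq_inv_mul] using (hsub2 j).const_mul (s j)⁻¹
  have h0 : ∀ j, ∫ x, h j x ∂Q = 0 := fun j => by
    rw [integral_div, integral_sub ((hker.memLp hpm (huΘ j)).integrable one_le_two)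
      (integrable_const 1), hker.integral_ratio hp0 hθ₀ (huΘ j)]
    simp
  have h1 : ∀ j, ∫ x, h j x * h j x ∂Q = 1 := fun j => by
    rw [hgram, ← sq (s j), hssq, mul_assoc, ← sq, div_self (hexp j).ne']
  have hbound : ∀ i j, i ≠ j → ∀ m : ℕ,
      ‖∫ x, h (m + i) x * h (m + j) x ∂Q‖ ≤ 4 * Real.exp (-(κ / 2 * (m : ℝ) ^ 2)) := by
    intro i j hij m
    rw [hgram, Real.norm_eq_abs]
    refine abs_exp_correlation_le hκ (hκu _) (hκu _) m.cast_nonneg ?_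
    rcases hij.lt_or_gt with hlt | hlt
    · have := hu m i j hlt
      rw [abs_sub_comm]
      exact (by linarith : (m : ℝ) ≤ _).trans (le_abs_self _)
    · have := hu m j i hlt
      exact (by linarith : (m : ℝ) ≤ _).trans (le_abs_self _)
  have hcorr : ∀ i j, i ≠ j →
      Tendsto (fun m => ∫ x, h (m + i) x * h (m + j) x ∂Q) atTop (𝓝 0) := fun i j hij => by
    refine squeeze_zero_norm (hbound i j hij) ?_
    rw [← mul_zero (4 : ℝ)]
    refine (Real.tendsto_exp_neg_atTop_nhds_zero.comp (Tendsto.const_mul_atTop (by positivity)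
      ((tendsto_pow_atTop two_ne_zero).comp tendsto_natCast_atTop_atTop))).const_mul 4
  have hb : ∀ j x, -(1 / s j) ≤ h j x := fun j x => by
    rw [← neg_div]
    refine div_le_div_of_nonneg_right ?_ (hspos j).le
    linarith [div_nonneg (hp _ (huΘ j) x) (hp0 x).le]
  obtain ⟨N, hN⟩ := exists_eventually_measure_sum_log_lt hindep hlaw hm h2 h0 h1 hcorr hb hT hη
  have hsmall : ∀ᶠ n : ℕ in atTop, ∀ j ∈ Finset.range N, T / 8 / √(n : ℝ) * (1 / s j) < 1 := by
    rw [eventually_all_finset]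
    intro j _
    have : Tendsto (fun n : ℕ => T / 8 / √(n : ℝ) * (1 / s j)) atTop (𝓝 (0 * (1 / s j))) :=
      ((Real.tendsto_sqrt_atTop.comp tendsto_natCast_atTop_atTop).const_div_atTop _).mul_const _
    rw [zero_mul] at this
    exact this.eventually_lt_const one_pos
  filter_upwards [hN, hsmall, eventually_gt_atTop 0] with n hn1 hn2 hn
  refine lt_of_le_of_lt (measure_mono ?_) hn1
  intro ω hω j hj
  by_contra hcon
  rw [not_lt] at hcon
  have hε1 := hn2 j (Finset.mem_range.2 hj)
  have hsj := hspos j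
  have hε0 : 0 ≤ T / 8 / √(n : ℝ) * (1 / s j) := by positivity
  have hn' : (0 : ℝ) < n := by exact_mod_cast hn
  -- With this weight `ε`, the perturbation `ε (p (u j) / p θ₀ - 1)` is `T / (8 √n)` times the
  -- normalized score `h j`, and `n ε² (s j)² = T² / 64`.
  refine hω ⟨twoPoint (T / 8 / √(n : ℝ) * (1 / s j)) θ₀ (u j),
    twoPoint_mem_mixingClass hε0 hε1.le hθ₀ (huΘ j), ?_, ?_⟩
  · rw [logLik_twoPoint_sub hε0 hε1 hp0 (hp _ (huΘ j))]
    refine hcon.trans_eq (Finset.sum_congr rfl fun i _ => ?_)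
    simp only [h]
    congr 2
    ring
  · rw [chiSq_twoPoint ν hε0 hε1.le hp0 (hsub2 j).integrable_sq]
    simp_rw [sq (_ - (1 : ℝ))]
    rw [hker.integral_sub_one_mul_sub_one hpm hp0 hθ₀ (huΘ j) (huΘ j), mul_assoc κ, ← sq (u j - θ₀),
      ← hssq, ← ENNReal.ofReal_natCast, ← ENNReal.ofReal_mul hn'.le]
    congr 1
    rw [mul_pow, div_pow, Real.sq_sqrt hn'.le]
    field_simp
    norm_num

theorem HasExponentialKernel.divergesInProbability {Ω : Type*} [MeasurableSpace Ω] {P : Measure Ω}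
    [IsProbabilityMeasure P] (hker : HasExponentialKernel ν p Θ θ₀ κ) (hκ : 0 < κ)
    (hpm : ∀ θ, Measurable (p θ)) (hp0 : ∀ x, 0 < p θ₀ x) (hp : ∀ θ ∈ Θ, ∀ x, 0 ≤ p θ x)
    (hΘ : ¬ Bornology.IsBounded Θ) (hθ₀ : θ₀ ∈ Θ) {X : ℕ → Ω → 𝒳} (hindep : iIndepFun X P)
    (hlaw : ∀ i, HasLaw (X i)
      (ν.withDensity fun x => ENNReal.ofReal (mixture p (Measure.dirac θ₀) x)) P)
    (ghat : ℕ → Ω → Measure ℝ) :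
    (∀ c : ℝ, 0 < c → DivergesInProbability P fun n ω =>
      ((supScaledChiSq p ν Θ (Measure.dirac θ₀) n (fun i => X i ω) (ghat n ω) c : ℝ≥0∞) :
        EReal)) ∧
    DivergesInProbability P fun n ω => lrStat p Θ (Measure.dirac θ₀) n (fun i => X i ω) := by
  have key := fun (T : ℝ) (hT : 0 < T) (η : ℝ≥0∞) (hη : η ≠ 0) =>
    hker.eventually_measure_lt hκ hpm hp0 hp hΘ hθ₀ hindep hlaw hT hη
  refine ⟨fun c hc M => ?_, fun M => ?_⟩
  · rw [ENNReal.tendsto_nhds_zero]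
    intro η hη
    have hM := abs_nonneg M
    -- For this `T`, `T² / 64 = (1 + |M| + c)²` exceeds `M` and `T² / 16` exceeds `c`, so the
    -- witness lies in the likelihood level set.
    filter_upwards [key (8 * (1 + |M| + c)) (by positivity) η hη.ne'] with n hn
    refine (measure_mono fun ω hω => ?_).trans hn.le
    rintro ⟨g, hg, hlik, hchi⟩
    have hmem : g ∈ likelihoodClass p Θ (Measure.dirac θ₀) n (fun i => X i ω) (ghat n ω) c :=
      Or.inl ⟨hg, by nlinarith⟩
    have hle : ENNReal.ofReal ((8 * (1 + |M| + c)) ^ 2 / 64) ≤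
        supScaledChiSq p ν Θ (Measure.dirac θ₀) n (fun i => X i ω) (ghat n ω) c := by
      rw [← hchi]
      exact le_iSup₂_of_le g hmem le_rfl
    have hω' := (EReal.coe_ennreal_le_coe_ennreal_iff.2 hle).trans hω
    rw [EReal.coe_ennreal_ofReal, EReal.coe_le_coe_iff] at hω'
    have := (le_max_left _ _).trans hω'
    nlinarith [le_abs_self M]
  · rw [ENNReal.tendsto_nhds_zero]
    intro η hη
    have hM := abs_nonneg M
    filter_upwards [key (8 * (1 + |M|)) (by positivity) η hη.ne'] with n hn
    refine (measure_mono fun ω hω => ?_).trans hn.le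
    rintro ⟨g, hg, hlik, -⟩
    have hω' := (le_iSup₂_of_le (f := fun g (_ : g ∈ mixingClass Θ) =>
      ((2 * (logLik (mixture p g) n (fun i => X i ω) -
        logLik (mixture p (Measure.dirac θ₀)) n (fun i => X i ω)) : ℝ) : EReal)) g hg le_rfl).trans hω
    rw [EReal.coe_le_coe_iff] at hω'
    nlinarith [le_abs_self M]

end Kernel

/-! ### The Gaussian and Poisson kernels -/

lemma measurable_gaussianDensity (θ : ℝ) : Measurable (gaussianDensity θ) :=
  measurable_gaussianPDFReal θ 1

lemma gaussianDensity_pos (θ x : ℝ) : 0 < gaussianDensity θ x :=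
  gaussianPDFReal_pos θ 1 x one_ne_zero

lemma poissonDensity_pos {θ : ℝ} (hθ : 0 < θ) (k : ℕ) : 0 < poissonDensity θ k := by
  unfold poissonDensity
  positivity

lemma integral_withDensity_mixture_dirac {𝒳 : Type*} [MeasurableSpace 𝒳] {ν : Measure 𝒳}
    {p : ℝ → 𝒳 → ℝ} {θ₀ : ℝ} (hpm : Measurable (p θ₀)) (hp0 : ∀ x, 0 < p θ₀ x) (f : 𝒳 → ℝ) :
    ∫ x, f x ∂(ν.withDensity fun x => ENNReal.ofReal (mixture p (Measure.dirac θ₀) x)) =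
      ∫ x, p θ₀ x * f x ∂ν := by
  rw [mixture_dirac, integral_withDensity_eq_integral_toReal_smul hpm.ennreal_ofReal
    (.of_forall fun x => ENNReal.ofReal_lt_top)]
  simp_rw [ENNReal.toReal_ofReal (hp0 _).le, smul_eq_mul]

/-- Completing the square, `p θ * p θ' / p θ₀` is the kernel value times the Gaussian density
centred at `θ + θ' - θ₀`. -/
lemma hasExponentialKernel_gaussian (Θ : Set ℝ) (θ₀ : ℝ) :
    HasExponentialKernel volume gaussianDensity Θ θ₀ 1 := by
  intro θ _ θ' _
  rw [integral_withDensity_mixture_dirac (measurable_gaussianDensity θ₀) (gaussianDensity_pos θ₀)]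
  have heq : ∀ x, gaussianDensity θ₀ x *
      (gaussianDensity θ x / gaussianDensity θ₀ x * (gaussianDensity θ' x / gaussianDensity θ₀ x)) =
      Real.exp (1 * (θ - θ₀) * (θ' - θ₀)) * gaussianPDFReal (θ + θ' - θ₀) 1 x := by
    intro x
    have h0 := (gaussianDensity_pos θ₀ x).ne'
    rw [show ∀ a b c : ℝ, a ≠ 0 → a * (b / a * (c / a)) = b * c / a by intros; field_simp,
      div_eq_iff h0]
    · simp only [gaussianDensity, gaussianPDFReal]
      have hexp : Real.exp (-(x - θ) ^ 2 / 2) * Real.exp (-(x - θ') ^ 2 / 2) =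
          Real.exp (1 * (θ - θ₀) * (θ' - θ₀)) * Real.exp (-(x - (θ + θ' - θ₀)) ^ 2 / 2) *
            Real.exp (-(x - θ₀) ^ 2 / 2) := by
        rw [← Real.exp_add, ← Real.exp_add, ← Real.exp_add]
        congr 1
        ring
      simp only [NNReal.coe_one, mul_one]
      linear_combination ((√(2 * Real.pi))⁻¹) ^ 2 * hexp
    · exact h0
  simp_rw [heq]
  rw [integral_const_mul, integral_gaussianPDFReal_eq_one _ one_ne_zero, mul_one]

/-- Here `p θ * p θ' / p θ₀` is an unnormalized Poisson density of mean `θ θ' / θ₀`. The exponential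
series gives the exponent `θ₀ - θ - θ' + θ θ' / θ₀`, which is `(θ - θ₀) (θ' - θ₀) / θ₀`. -/
lemma hasExponentialKernel_poisson {Θ : Set ℝ} (hΘ : Θ ⊆ Set.Ioi 0) {θ₀ : ℝ} (hθ₀ : θ₀ ∈ Θ) :
    HasExponentialKernel Measure.count poissonDensity Θ θ₀ (1 / θ₀) := by
  intro θ hθ θ' hθ'
  have h0 : 0 < θ₀ := hΘ hθ₀
  have h1 : 0 < θ := hΘ hθ
  have h2 : 0 < θ' := hΘ hθ'
  rw [integral_withDensity_mixture_dirac (measurable_of_countable _) (poissonDensity_pos h0)]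
  have heq : ∀ k : ℕ, poissonDensity θ₀ k *
      (poissonDensity θ k / poissonDensity θ₀ k * (poissonDensity θ' k / poissonDensity θ₀ k)) =
      Real.exp (θ₀ - θ - θ') * ((θ * θ' / θ₀) ^ k / (k.factorial : ℝ)) := by
    intro k
    have hk : (0 : ℝ) < k.factorial := by exact_mod_cast k.factorial_pos
    simp only [poissonDensity]
    rw [show θ₀ - θ - θ' = θ₀ + (-θ + -θ') by ring, Real.exp_add, Real.exp_add, Real.exp_neg θ₀,
      div_pow, mul_pow]
    have := Real.exp_pos θ₀
    field_simp
  simp_rw [heq]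
  rw [integral_const_mul]
  have hsum : HasSum (fun k : ℕ => (θ * θ' / θ₀) ^ k / (k.factorial : ℝ))
      (Real.exp (θ * θ' / θ₀)) := by
    rw [Real.exp_eq_exp_ℝ]
    exact NormedSpace.expSeries_div_hasSum_exp _
  have hint : Integrable (fun k : ℕ => (θ * θ' / θ₀) ^ k / (k.factorial : ℝ)) Measure.count := by
    rw [integrable_count_iff]
    exact hsum.summable.norm
  rw [integral_countable hint]
  simp only [Measure.real, Measure.count_singleton, ENNReal.toReal_one, one_smul]
  rw [hsum.tsum_eq, ← Real.exp_add]
  congr 1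
  field_simp
  ring

end MixtureNPMLE

theorem mainTheorem11 {Ω : Type*} [MeasurableSpace Ω] (P : Measure Ω) [IsProbabilityMeasure P] :
    -- Gaussian case
    (∀ (Θ : Set ℝ) (θ₀ : ℝ) (X : ℕ → Ω → ℝ) (ghat : ℕ → Ω → Measure ℝ),
      ¬ Bornology.IsBounded Θ → θ₀ ∈ Θ →
      iIndepFun X P →
      (∀ i, HasLaw (X i) ((volume : Measure ℝ).withDensity fun x => ENNReal.ofReal
        (MixtureNPMLE.mixture MixtureNPMLE.gaussianDensity (Measure.dirac θ₀) x)) P) →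
      (∀ n ω, (MixtureNPMLE.npmleSet MixtureNPMLE.gaussianDensity Θ n (fun i => X i ω)).Nonempty →
        ghat n ω ∈ MixtureNPMLE.npmleSet MixtureNPMLE.gaussianDensity Θ n (fun i => X i ω)) →
      (∀ c : ℝ, 0 < c → MixtureNPMLE.DivergesInProbability P fun n ω =>
        ((MixtureNPMLE.supScaledChiSq MixtureNPMLE.gaussianDensity volume Θ (Measure.dirac θ₀) n
          (fun i => X i ω) (ghat n ω) c : ℝ≥0∞) : EReal)) ∧
      MixtureNPMLE.DivergesInProbability P fun n ω =>
        MixtureNPMLE.lrStat MixtureNPMLE.gaussianDensity Θ (Measure.dirac θ₀) n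
          (fun i => X i ω)) ∧
    -- Poisson case
    (∀ (Θ : Set ℝ) (θ₀ : ℝ) (X : ℕ → Ω → ℕ) (ghat : ℕ → Ω → Measure ℝ),
      Θ ⊆ Set.Ioi 0 → ¬ Bornology.IsBounded Θ → θ₀ ∈ Θ →
      iIndepFun X P →
      (∀ i, HasLaw (X i) ((Measure.count : Measure ℕ).withDensity fun k => ENNReal.ofReal
        (MixtureNPMLE.mixture MixtureNPMLE.poissonDensity (Measure.dirac θ₀) k)) P) →
      (∀ n ω, (MixtureNPMLE.npmleSet MixtureNPMLE.poissonDensity Θ n (fun i => X i ω)).Nonempty →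
        ghat n ω ∈ MixtureNPMLE.npmleSet MixtureNPMLE.poissonDensity Θ n (fun i => X i ω)) →
      (∀ c : ℝ, 0 < c → MixtureNPMLE.DivergesInProbability P fun n ω =>
        ((MixtureNPMLE.supScaledChiSq MixtureNPMLE.poissonDensity Measure.count Θ
          (Measure.dirac θ₀) n (fun i => X i ω) (ghat n ω) c : ℝ≥0∞) : EReal)) ∧
      MixtureNPMLE.DivergesInProbability P fun n ω =>
        MixtureNPMLE.lrStat MixtureNPMLE.poissonDensity Θ (Measure.dirac θ₀) n
          (fun i => X i ω)) := by
  refine ⟨fun Θ θ₀ X ghat hΘ hθ₀ hindep hlaw _ => ?_,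
    fun Θ θ₀ X ghat hpos hΘ hθ₀ hindep hlaw _ => ?_⟩
  · exact (MixtureNPMLE.hasExponentialKernel_gaussian Θ θ₀).divergesInProbability one_pos
      MixtureNPMLE.measurable_gaussianDensity (MixtureNPMLE.gaussianDensity_pos θ₀)
      (fun θ _ x => (MixtureNPMLE.gaussianDensity_pos θ x).le) hΘ hθ₀ hindep hlaw ghat
  · exact (MixtureNPMLE.hasExponentialKernel_poisson hpos hθ₀).divergesInProbability
      (one_div_pos.2 (hpos hθ₀)) (fun _ => measurable_of_countable _)
      (MixtureNPMLE.poissonDensity_pos (hpos hθ₀))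
      (fun θ hθ x => (MixtureNPMLE.poissonDensity_pos (hpos hθ) x).le) hΘ hθ₀ hindep hlaw ghat
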